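/- Let $m,n$ be natural numbers and let $G$ be a normalized uniform multigame with agents $I=\{1,\dots,n\}$, local games $J=\{1,\dots,m\}$ and two actions $C,D$ for every agent. That is, $G$ consists of payoffs $u_{ij}:\{C,D\}^n\to\mathbb R$ ($i\in I$, $j\in J$), type spaces $\Theta_i\subset\{\theta\in\mathbb R^m:\theta_j\ge 0,\ \sum_{j}\theta_j=1\}$ ($i\in I$), and, for every agent $i$, a probability measure $p_i$ on $\Theta_{-i}=\prod_{k\ne i}\Theta_k$, the belief of agent $i$ about the types of the other agents; types are independent, so $p_i$ does not depend on the type of $i$. An agent plays the same action in all local games, and the utility of agent $i$ of type $\theta_i$ under the action profile $c\in\{C,D\}^n$ is $\sum_{j\in J}\theta_{ij}u_{ij}(c)$. Assume that 1. every $\Theta_i$ is compact; 2. every $p_i$ is absolutely continuous with respect to the Lebesgue measure on $\Theta_{-i}$, i.e. the product of the $(m-1)$-dimensional Lebesgue measures on the sets $\Theta_k$, $k\neq i$, regarded as subsets of the hyperplane $\{\theta:\sum_j\theta_j=1\}$; 3. every agent $i$ has a local game $j$ that is purely cooperative for $i$, meaning $u_{ij}(C,c_{-i})>u_{ij}(D,c_{-i})$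 for all $c_{-i}\in\{C,D\}^{I\setminus\{i\}}$, or purely competitive for $i$, meaning $u_{ij}(C,c_{-i})<u_{ij}(D,c_{-i})$ for all $c_{-i}$. Then $G$ has a pure Bayesian Nash equilibrium: there are measurable maps $s_i:\Theta_i\to\{C,D\}$ ($i\in I$) such that for every agent $i$, every type $\theta_i\in\Theta_i$ and every action $c\in\{C,D\}$ $$\int_{\Theta_{-i}}\sum_{j\in J}\theta_{ij}\,u_{ij}\bigl(s_i(\theta_i),s_{-i}(\theta_{-i})\bigr)\,dp_i(\theta_{-i})\ \ge\ \int_{\Theta_{-i}}\sum_{j\in J}\theta_{ij}\,u_{ij}\bigl(c,s_{-i}(\theta_{-i})\bigr)\,dp_i(\theta_{-i}),$$ where $s_{-i}(\theta_{-i})=(s_k(\theta_k))_{k\ne i}$. -/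

import Mathlib

open MeasureTheory

noncomputable section

/-- The space `ℝ^m` in which the types of the agents live. -/
abbrev TypeVector (m : ℕ) : Type := EuclideanSpace ℝ (Fin m)

/-- The vectors of `ℝ^m` whose coordinates add up to `0`: the direction of the affine hyperplane
`{x | ∑ j, x j = 1}`. -/
def sumZero (m : ℕ) : Submodule ℝ (TypeVector m) :=
  LinearMap.ker (∑ j : Fin m, (EuclideanSpace.proj j : TypeVector m →L[ℝ] ℝ).toLinearMap)

/-- The barycentre `(1/m, …, 1/m)` of the standard simplex. -/
def barycentre (m : ℕ) : TypeVector m := WithLp.toLp 2 fun _ => (m : ℝ)⁻¹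

/-- The `(m-1)`-dimensional Lebesgue measure on the affine hyperplane `{x | ∑ j, x j = 1}` of
`ℝ^m` (as a measure on `ℝ^m`): the translate of the Lebesgue measure of the Euclidean space
`sumZero m`. -/
def hyperplaneVolume (m : ℕ) : Measure (TypeVector m) :=
  Measure.map (fun v : sumZero m => barycentre m + (v : TypeVector m)) volume

/-- Uniform multigames `G_{m,n,a}` with `m` local games, `n` agents and `a` actions per agent.
Every agent plays one and the same action in all local games, and the agents' types are
independent, so that the belief of agent `i` about the types of the other agents does not depend
on the type of `i`. Beliefs may be subjective. -/
structure UniformMultigame (m n a : ℕ) where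
  /-- `util i j c` is the payoff `u_{ij}(c)` of agent `i` in the local game `j` when the agents
  play the action profile `c`. -/
  util : Fin n → Fin m → (Fin n → Fin a) → ℝ
  /-- The bound `w_i` on the total weight of a type of agent `i`. -/
  weight : Fin n → ℝ
  weight_pos : ∀ i, 0 < weight i
  /-- The type space `Θ_i` of agent `i`. -/
  types : Fin n → Set (TypeVector m)
  types_nonneg : ∀ i, ∀ θ ∈ types i, ∀ j, 0 ≤ θ j
  types_sum_le : ∀ i, ∀ θ ∈ types i, ∑ j, θ j ≤ weight i
  /-- The probability distribution `p_i` on `Θ_{-i} = ∏_{k ≠ i} Θ_k`: what agent `i` believes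
  about the types of the other agents. -/
  prior : ∀ i : Fin n, Measure (∀ k : {k : Fin n // k ≠ i}, types k)
  prior_prob : ∀ i, IsProbabilityMeasure (prior i)

namespace UniformMultigame

variable {m n a : ℕ}

/-- The action profile `(c_i, c_{-i})`. -/
def profile (i : Fin n) (c : Fin a) (c' : {k : Fin n // k ≠ i} → Fin a) : Fin n → Fin a :=
  fun k => if h : k = i then c else c' ⟨k, h⟩

/-- The overall utility `∑ j, θ_{ij} u_{ij}(c)` of agent `i` of type `θ_i` under the action
profile `c`. -/
def totalUtility (G : UniformMultigame m n a) (i : Fin n) (θ : G.types i)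
    (c : Fin n → Fin a) : ℝ :=
  ∑ j, (θ : TypeVector m) j * G.util i j c

/-- The multigame is normalized: `w_i = 1` for every agent, and the coefficients of every type
add up to `1`. -/
def IsNormalized (G : UniformMultigame m n a) : Prop :=
  (∀ i, G.weight i = 1) ∧ ∀ i, ∀ θ ∈ G.types i, ∑ j, θ j = 1

/-- The type spaces are compact. -/
def HasCompactTypes (G : UniformMultigame m n a) : Prop :=
  ∀ i, IsCompact (G.types i)

/-- The `(m-1)`-dimensional Lebesgue measure on the type space `Θ_i` of a normalized
multigame. -/
def typeVolume (G : UniformMultigame m n a) (i : Fin n) : Measure (G.types i) :=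
  (hyperplaneVolume m).comap Subtype.val

/-- Every belief `p_i` is absolutely continuous with respect to the Lebesgue measure on
`Θ_{-i}`, the product of the `(m-1)`-dimensional Lebesgue measures on the `Θ_k`, `k ≠ i`. -/
def HasContinuousPrior (G : UniformMultigame m n a) : Prop :=
  ∀ i, G.prior i ≪ Measure.pi fun k : {k : Fin n // k ≠ i} => G.typeVolume k

/-- Profiles of pure strategies: maps `s_i : Θ_i → A_i`, one for each agent. -/
abbrev StrategyProfile (G : UniformMultigame m n a) : Type :=
  ∀ i : Fin n, G.types i → Fin a

/-- The expected utility of agent `i` of type `θ_i` that plays the action `c`, when every other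
agent `k` follows the pure strategy `s_k`. -/
def expectedUtility (G : UniformMultigame m n a) (i : Fin n) (c : Fin a) (θ : G.types i)
    (s : G.StrategyProfile) : ℝ :=
  ∫ t, G.totalUtility i θ (profile i c fun k => s k (t k)) ∂(G.prior i)

/-- `s` is a pure Bayesian Nash equilibrium: every `s_i` is measurable, and for every type
`θ_i` of every agent `i` the action `s_i(θ_i)` maximizes the expected utility of `i`. -/
def IsPureBayesianNash (G : UniformMultigame m n a) (s : G.StrategyProfile) : Prop :=
  (∀ i, Measurable (s i)) ∧
    ∀ i, ∀ θ : G.types i, ∀ c : Fin a,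
      G.expectedUtility i c θ s ≤ G.expectedUtility i (s i θ) θ s

/-- Cooperation, the first of the two actions of a game with two actions. -/
abbrev actionC : Fin 2 := 0

/-- Defection, the second of the two actions of a game with two actions. -/
abbrev actionD : Fin 2 := 1

/-- The local game `j` is purely cooperative for agent `i`. -/
def IsPurelyCooperative (G : UniformMultigame m n 2) (i : Fin n) (j : Fin m) : Prop :=
  ∀ c' : {k : Fin n // k ≠ i} → Fin 2,
    G.util i j (profile i actionD c') < G.util i j (profile i actionC c')

/-- The local game `j` is purely competitive for agent `i`. -/
def IsPurelyCompetitive (G : UniformMultigame m n 2) (i : Fin n) (j : Fin m) : Prop :=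
  ∀ c' : {k : Fin n // k ≠ i} → Fin 2,
    G.util i j (profile i actionC c') < G.util i j (profile i actionD c')

end UniformMultigame

end

/-! Against fixed opponents, agent `i` prefers `C` exactly when the pairing of `θ_i` with the vector
`w_i` of expected gains is nonnegative. Strategies are therefore parametrized by finitely many real
numbers, and an equilibrium is a fixed point of the map sending `w` to the expected gains under
`halfspaceStrategy w`. This map is bounded. It is continuous where every `w_i ≠ 0`, since only types
orthogonal to `w_i` can switch action and these are null for the beliefs. Clamping each weight to
the range of the gain keeps the coordinate of a pure game away from `0` and changes no fixed point,
so Brouwer's theorem applies.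

Brouwer's theorem is proved by the volume argument: the integral of `det (1 + t • Dg)` over a ball
is polynomial in `t` and equals the volume for small `t > 0`, hence also at `t = 1`; a retraction
onto the sphere would make it zero there. -/

/-! ### Brouwer's fixed point theorem. -/

/-- Lagrange interpolation of a polynomial in `t` of degree at most `dim E`. As `c` does not depend
on `A`, the identity can be integrated, with nodes as small as needed. -/
theorem exists_det_one_add_eq_sum (E : Type*) [NormedAddCommGroup E] [NormedSpace ℝ E]
    [FiniteDimensional ℝ E] (v : ℕ → ℝ) (hv : Function.Injective v) :
    ∃ c : ℕ → ℝ, ∑ k ∈ Finset.range (Module.finrank ℝ E + 1), c k = 1 ∧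
      ∀ A : E →L[ℝ] E, (1 + A).det =
        ∑ k ∈ Finset.range (Module.finrank ℝ E + 1), c k * (1 + v k • A).det := by
  classical
  set s := Finset.range (Module.finrank ℝ E + 1)
  have hvs : Set.InjOn v s := hv.injOn
  refine ⟨fun k => (Lagrange.basis s v k).eval 1, ?_, fun A => ?_⟩
  · rw [← Polynomial.eval_finsetSum, Lagrange.sum_basis hvs (by simp [s]), Polynomial.eval_one]
  · let b := Module.finBasis ℝ E
    let M := LinearMap.toMatrix b b A.toLinearMap
    let f : Polynomial ℝ :=
      ((Polynomial.X : Polynomial ℝ) • M.map Polynomial.C + (1 : Matrix _ _ ℝ).map Polynomial.C).det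
    have hf : ∀ t : ℝ, (1 + t • A).det = f.eval t := by
      intro t
      have h1 : (1 + t • A).det = (1 + t • M).det := by
        rw [ContinuousLinearMap.det, ← LinearMap.det_toMatrix b]
        congr 1
        simp [M, ContinuousLinearMap.one_def]
      rw [h1, ← Polynomial.coe_evalRingHom, RingHom.map_det]
      congr 1
      ext i j
      simp [Matrix.one_apply, apply_ite, add_comm, mul_comm t]
    have hdeg : f.degree < s.card := by
      refine lt_of_le_of_lt Polynomial.degree_le_natDegree ?_
      have := Polynomial.natDegree_det_X_add_C_le M 1
      simp only [Fintype.card_fin] at this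
      simp only [s, Finset.card_range]
      exact_mod_cast Nat.lt_succ_of_le this
    have h := congrArg (Polynomial.eval 1) (Lagrange.eq_interpolate hvs hdeg)
    have h1 := hf 1
    rw [one_smul] at h1
    rw [h1, h, Lagrange.interpolate_apply, Polynomial.eval_finsetSum]
    refine Finset.sum_congr rfl fun k _ => ?_
    rw [Polynomial.eval_mul, Polynomial.eval_C, ← hf, mul_comm]

theorem bijective_id_add_of_lipschitzWith {E : Type*} [NormedAddCommGroup E] [CompleteSpace E]
    {h : E → E} {K : NNReal} (hK : K < 1) (hh : LipschitzWith K h) :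
    Function.Bijective fun x => x + h x := by
  refine ⟨fun x y hxy => ?_, fun y => ?_⟩
  · have h1 : dist x y = dist (h x) (h y) := by
      have : x - y = h y - h x := by
        have : x + h x = y + h y := hxy
        rw [sub_eq_sub_iff_add_eq_add, this, add_comm]
      rw [dist_eq_norm, this, dist_comm, dist_eq_norm]
    have h2 := hh.dist_le_mul x y
    have h3 : (K : ℝ) < 1 := hK
    have h4 : dist x y = 0 := by
      nlinarith [dist_nonneg (x := x) (y := y)]
    exact dist_eq_zero.1 h4
  · have hc : ContractingWith K fun x => y - h x :=
      ⟨hK, LipschitzWith.of_dist_le_mul fun a b => by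
        rw [dist_sub_left]; exact hh.dist_le_mul a b⟩
    obtain ⟨x, hx, -⟩ := hc.exists_fixedPoint 0 (edist_ne_top _ _)
    have hx' : y - h x = x := hx
    exact ⟨x, by simp only; nth_rewrite 1 [← hx']; abel⟩

theorem image_id_add_of_lipschitzWith {E : Type*} [NormedAddCommGroup E] [CompleteSpace E]
    {h : E → E} {K : NNReal} (hK : K < 1) (hh : LipschitzWith K h) {s : Set E}
    (h0 : ∀ x ∉ s, h x = 0) : (fun x => x + h x) '' s = s := by
  have hb := bijective_id_add_of_lipschitzWith hK hh
  ext y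
  constructor
  · rintro ⟨x, hx, rfl⟩
    by_contra hy
    have : x + h x + h (x + h x) = x + h x := by rw [h0 _ hy, add_zero]
    exact hy (by rwa [← hb.1 this] at hx)
  · intro hy
    obtain ⟨x, rfl⟩ := hb.2 y
    refine ⟨x, ?_, rfl⟩
    by_contra hx
    simp only [h0 x hx, add_zero] at hy
    exact hx hy

theorem exists_det_one_add_pos (E : Type*) [NormedAddCommGroup E] [NormedSpace ℝ E]
    [FiniteDimensional ℝ E] :
    ∃ ε > 0, ∀ A : E →L[ℝ] E, ‖A‖ < ε → 0 < (1 + A).det := by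
  have hc : ContinuousAt (fun A : E →L[ℝ] E => (1 + A).det) 0 := by
    exact ((ContinuousLinearMap.continuous_det (𝕜 := ℝ) (E := E)).comp
      (continuous_const.add continuous_id)).continuousAt
  have h0 : (0 : ℝ) < (1 + (0 : E →L[ℝ] E)).det := by
    rw [add_zero]; simp [ContinuousLinearMap.det, ContinuousLinearMap.one_def]
  obtain ⟨ε, hε, h⟩ := Metric.eventually_nhds_iff.1 (hc.eventually (lt_mem_nhds h0))
  exact ⟨ε, hε, fun A hA => h (by simpa using hA)⟩

/-- For small `t > 0` the map `id + t • g` permutes the ball with positive Jacobian, so its Jacobian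
integrates to the volume; interpolation carries this to `t = 1`. -/
theorem exists_det_one_add_fderiv_ne_zero {E : Type*} [NormedAddCommGroup E] [NormedSpace ℝ E]
    [FiniteDimensional ℝ E] {g : E → E} {K : NNReal} (hg : LipschitzWith K g) {r : ℝ} (hr : 0 < r)
    (h0 : ∀ x, x ∉ Metric.ball 0 r → g x = 0)
    (hd : ∀ x ∈ Metric.ball 0 r, DifferentiableAt ℝ g x) :
    ∃ x ∈ Metric.ball 0 r, (1 + fderiv ℝ g x).det ≠ 0 := by
  by_contra! hdet
  borelize E
  let μ : Measure E := Measure.addHaar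
  obtain ⟨ε, hε, hpos⟩ := exists_det_one_add_pos E
  obtain ⟨δ, hδ, hδε, hδ1⟩ : ∃ δ : ℝ, 0 < δ ∧ δ * K < ε ∧ δ * K < 1 := by
    have hK : (0 : ℝ) ≤ K := K.2
    refine ⟨min ε 1 / (K + 1), by positivity, ?_, ?_⟩
    · rw [div_mul_eq_mul_div, div_lt_iff₀ (by positivity)]
      nlinarith [min_le_left ε 1, lt_min hε one_pos]
    · rw [div_mul_eq_mul_div, div_lt_iff₀ (by positivity)]
      nlinarith [min_le_right ε 1, lt_min hε one_pos]
  let v : ℕ → ℝ := fun k => δ / (k + 1)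
  have hv : Function.Injective v := by
    intro a b hab
    have ha : (a : ℝ) + 1 ≠ 0 := by positivity
    have hb : (b : ℝ) + 1 ≠ 0 := by positivity
    simp only [v] at hab
    rw [div_eq_div_iff ha hb] at hab
    have := mul_left_cancel₀ hδ.ne' hab
    exact_mod_cast (add_right_cancel this).symm
  have hv0 : ∀ k, 0 < v k := fun k => by positivity
  have hvδ : ∀ k, v k ≤ δ := fun k => div_le_self hδ.le (by simp)
  have hvol : ∀ k, ∫ x in Metric.ball (0 : E) r, (1 + v k • fderiv ℝ g x).det ∂μ
      = μ.real (Metric.ball 0 r) := by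
    intro k
    have hcoe : ((v k).toNNReal : ℝ) = v k := Real.coe_toNNReal _ (hv0 k).le
    have hlip : LipschitzWith ((v k).toNNReal * K) fun x => v k • g x := by
      refine LipschitzWith.of_dist_le_mul fun x y => ?_
      rw [dist_smul₀, Real.norm_of_nonneg (hv0 k).le, NNReal.coe_mul, hcoe, mul_assoc]
      exact mul_le_mul_of_nonneg_left (hg.dist_le_mul x y) (hv0 k).le
    have hlt : (v k).toNNReal * K < 1 := by
      rw [← NNReal.coe_lt_coe, NNReal.coe_mul, hcoe]
      exact (mul_le_mul_of_nonneg_right (hvδ k) K.2).trans_lt hδ1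
    have himg := image_id_add_of_lipschitzWith hlt hlip (s := Metric.ball 0 r)
      (fun x hx => by simp [h0 x hx])
    have hder : ∀ x ∈ Metric.ball (0 : E) r, HasFDerivWithinAt (fun x => x + v k • g x)
        (1 + v k • fderiv ℝ g x) (Metric.ball 0 r) x := fun x hx =>
      ((hasFDerivAt_id x).add ((hd x hx).hasFDerivAt.const_smul (v k))).hasFDerivWithinAt
    have h := integral_image_eq_integral_abs_det_fderiv_smul μ Metric.isOpen_ball.measurableSet hder
      (bijective_id_add_of_lipschitzWith hlt hlip).1.injOn fun _ => (1 : ℝ)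
    rw [himg] at h
    simp only [smul_eq_mul, mul_one, integral_const, MeasurableSet.univ,
      measureReal_restrict_apply, Set.univ_inter] at h
    rw [h]
    refine setIntegral_congr_fun Metric.isOpen_ball.measurableSet fun x _ => ?_
    refine (abs_of_pos (hpos _ ?_)).symm
    rw [norm_smul, Real.norm_of_nonneg (hv0 k).le]
    exact (mul_le_mul (hvδ k) (norm_fderiv_le_of_lipschitz ℝ hg) (norm_nonneg _) hδ.le).trans_lt hδε
  obtain ⟨c, hc1, hc⟩ := exists_det_one_add_eq_sum E v hv
  have hne : μ.real (Metric.ball (0 : E) r) ≠ 0 :=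
    (ENNReal.toReal_pos (Metric.measure_ball_pos μ _ hr).ne' measure_ball_lt_top.ne).ne'
  -- A non-integrable function has integral `0` by convention, so a nonzero integral gives
  -- integrability.
  have hint : ∀ k, IntegrableOn (fun x => c k * (1 + v k • fderiv ℝ g x).det)
      (Metric.ball (0 : E) r) μ := fun k =>
    (Integrable.of_integral_ne_zero (by rw [hvol k]; exact hne)).const_mul _
  have hzero : ∫ x in Metric.ball (0 : E) r, (1 + fderiv ℝ g x).det ∂μ = 0 :=
    setIntegral_eq_zero_of_forall_eq_zero hdet
  rw [integral_congr_ae (.of_forall fun x => hc _), integral_finsetSum _ fun k _ => hint k] at hzero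
  simp_rw [integral_const_mul, hvol, ← Finset.sum_mul, hc1, one_mul] at hzero
  exact hne hzero

/-- A segment leaving the ball crosses the sphere, where `h` vanishes, so the constant `K` survives.
-/
theorem lipschitzWith_indicator_ball {E F : Type*} [NormedAddCommGroup E] [NormedSpace ℝ E]
    [NormedAddCommGroup F] {h : E → F} {r : ℝ} {K : NNReal}
    (hh : LipschitzOnWith K h (Metric.closedBall 0 r)) (h0 : ∀ x ∈ Metric.sphere 0 r, h x = 0) :
    LipschitzWith K ((Metric.ball 0 r).indicator h) := by
  have key : ∀ x y, x ∈ Metric.ball (0 : E) r →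
      dist ((Metric.ball 0 r).indicator h x) ((Metric.ball 0 r).indicator h y) ≤ K * dist x y := by
    intro x y hx
    by_cases hy : y ∈ Metric.ball (0 : E) r
    · rw [Set.indicator_of_mem hx, Set.indicator_of_mem hy]
      exact hh.dist_le_mul _ (Metric.ball_subset_closedBall hx) _ (Metric.ball_subset_closedBall hy)
    · obtain ⟨t, ht, hz⟩ : r ∈ (fun t : ℝ => ‖AffineMap.lineMap x y t‖) '' Set.Icc 0 1 := by
        refine intermediate_value_Icc zero_le_one ?_ ⟨?_, ?_⟩
        · exact (AffineMap.lineMap_continuous (R := ℝ)).norm.continuousOn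
        · simpa using (mem_ball_zero_iff.1 hx).le
        · simpa using hy
      have hz' : AffineMap.lineMap x y t ∈ Metric.sphere (0 : E) r := mem_sphere_zero_iff_norm.2 hz
      have h1 := hh.dist_le_mul _ (Metric.ball_subset_closedBall hx) _
        (Metric.sphere_subset_closedBall hz')
      rw [h0 _ hz'] at h1
      rw [Set.indicator_of_mem hx, Set.indicator_of_notMem hy]
      refine h1.trans (mul_le_mul_of_nonneg_left ?_ K.2)
      rw [dist_left_lineMap, Real.norm_of_nonneg ht.1]
      exact mul_le_of_le_one_left dist_nonneg ht.2
  refine LipschitzWith.of_dist_le_mul fun x y => ?_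
  by_cases hx : x ∈ Metric.ball (0 : E) r
  · exact key x y hx
  by_cases hy : y ∈ Metric.ball (0 : E) r
  · rw [dist_comm, dist_comm x]
    exact key y x hy
  · rw [Set.indicator_of_notMem hx, Set.indicator_of_notMem hy, dist_self]
    positivity

theorem exists_norm_add_ne_of_eq_zero_on_sphere {E : Type*} [NormedAddCommGroup E]
    [InnerProductSpace ℝ E] [FiniteDimensional ℝ E] {h : E → E} {r : ℝ} (hr : 0 < r)
    (hh : ContDiffOn ℝ 1 h (Metric.closedBall 0 r)) (h0 : ∀ x ∈ Metric.sphere 0 r, h x = 0) :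
    ∃ x ∈ Metric.ball (0 : E) r, ‖x + h x‖ ≠ r := by
  by_contra! hn
  obtain ⟨K, hK⟩ := hh.exists_lipschitzOnWith one_ne_zero (convex_closedBall _ _)
    (isCompact_closedBall _ _)
  set g := (Metric.ball 0 r).indicator h
  have hgx : ∀ x ∈ Metric.ball (0 : E) r, g x = h x := fun x hx => Set.indicator_of_mem hx h
  have hgh : ∀ x ∈ Metric.ball (0 : E) r, g =ᶠ[nhds x] h := fun x hx => by
    filter_upwards [Metric.isOpen_ball.mem_nhds hx] with y hy using hgx y hy
  have hd : ∀ x ∈ Metric.ball (0 : E) r, DifferentiableAt ℝ g x := fun x hx =>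
    ((hh.differentiableOn one_ne_zero).differentiableAt
      (Metric.closedBall_mem_nhds_of_mem hx)).congr_of_eventuallyEq (hgh x hx)
  obtain ⟨x, hx, hdet⟩ := exists_det_one_add_fderiv_ne_zero (lipschitzWith_indicator_ball hK h0) hr
    (fun x hx => Set.indicator_of_notMem hx h) hd
  have hφ : HasFDerivAt (fun y => y + g y) (1 + fderiv ℝ g x) x :=
    (hasFDerivAt_id x).add (hd x hx).hasFDerivAt
  have hconst : (fun y => ‖y + g y‖ ^ 2) =ᶠ[nhds x] fun _ => r ^ 2 := by
    filter_upwards [Metric.isOpen_ball.mem_nhds hx] with y hy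
    rw [hgx y hy, hn y hy]
  have hder := (hφ.norm_sq.congr_of_eventuallyEq hconst.symm).unique (hasFDerivAt_const _ _)
  have hsurj : Function.Surjective (1 + fderiv ℝ g x : E →L[ℝ] E) := by
    have hunit : IsUnit (LinearMap.det (1 + fderiv ℝ g x : E →L[ℝ] E).toLinearMap) := IsUnit.mk0 _ hdet
    exact LinearMap.range_eq_top.1 ((LinearMap.isUnit_iff_range_eq_top _).1
      ((LinearMap.isUnit_iff_isUnit_det _).2 hunit))
  -- Constancy of the norm makes the range of the derivative orthogonal to `x + g x`; surjectivity
  -- puts that vector in the range.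
  obtain ⟨v, hv⟩ := hsurj (x + g x)
  have h1 : 2 • inner ℝ (x + g x) ((1 + fderiv ℝ g x : E →L[ℝ] E) v) = 0 :=
    congrArg (fun L => L v) hder
  rw [hv, real_inner_self_eq_norm_sq, hgx x hx, hn x hx, two_nsmul] at h1
  nlinarith [pow_pos hr 2]

/-- Without a zero, pushing `x` along `u x` until it meets the sphere would be a `C¹` retraction of
the ball. -/
theorem exists_eq_zero_of_inner_pos_on_sphere {E : Type*} [NormedAddCommGroup E]
    [InnerProductSpace ℝ E] [FiniteDimensional ℝ E] {u : E → E} {r : ℝ} (hr : 0 < r)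
    (hu : ContDiff ℝ 1 u) (hpos : ∀ x ∈ Metric.sphere 0 r, 0 < inner ℝ x (u x)) :
    ∃ x ∈ Metric.closedBall (0 : E) r, u x = 0 := by
  by_contra! hne
  let a : E → ℝ := fun x => ‖u x‖ ^ 2
  let b : E → ℝ := fun x => inner ℝ x (u x)
  let d : E → ℝ := fun x => b x ^ 2 + a x * (r ^ 2 - ‖x‖ ^ 2)
  have ha : ContDiff ℝ 1 a := hu.norm_sq ℝ
  have hb : ContDiff ℝ 1 b := contDiff_id.inner ℝ hu
  have hdc : ContDiff ℝ 1 d := (hb.pow 2).add (ha.mul (contDiff_const.sub (contDiff_norm_sq ℝ)))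
  have ha0 : ∀ x ∈ Metric.closedBall (0 : E) r, 0 < a x := fun x hx => by
    have := norm_pos_iff.2 (hne x hx)
    positivity
  have hd0 : ∀ x ∈ Metric.closedBall (0 : E) r, 0 < d x := by
    intro x hx
    have h1 := ha0 x hx
    rcases (mem_closedBall_zero_iff.1 hx).lt_or_eq with h | h
    · have : 0 < r ^ 2 - ‖x‖ ^ 2 := by nlinarith [norm_nonneg x]
      positivity
    · have := hpos x (mem_sphere_zero_iff_norm.2 h)
      have h2 : 0 < b x ^ 2 := pow_pos this 2
      simpa [d, h] using h2
  -- The larger root of `‖x + l • u x‖ ^ 2 = r ^ 2`; since `b > 0` on the sphere, it vanishes there.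
  let l : E → ℝ := fun x => (-b x + √(d x)) / a x
  have hl : ContDiffOn ℝ 1 (fun x => l x • u x) (Metric.closedBall 0 r) :=
    ((hb.neg.contDiffOn.add (hdc.contDiffOn.sqrt fun x hx => (hd0 x hx).ne')).div ha.contDiffOn
      fun x hx => (ha0 x hx).ne').smul hu.contDiffOn
  obtain ⟨x, hx, hxr⟩ := exists_norm_add_ne_of_eq_zero_on_sphere hr hl fun x hx => by
    have h1 : d x = b x ^ 2 := by simp [d, mem_sphere_zero_iff_norm.1 hx]
    simp [l, h1, Real.sqrt_sq (hpos x hx).le, b]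
  apply hxr
  have hx' := Metric.ball_subset_closedBall hx
  have hsq : √(d x) ^ 2 = d x := Real.sq_sqrt (hd0 x hx').le
  have hla : l x * a x = -b x + √(d x) := div_mul_cancel₀ _ (ha0 x hx').ne'
  rw [← sq_eq_sq₀ (norm_nonneg _) hr.le, norm_add_sq_real, inner_smul_right, norm_smul, mul_pow,
    Real.norm_eq_abs, sq_abs]
  change ‖x‖ ^ 2 + 2 * (l x * b x) + l x ^ 2 * a x = r ^ 2
  refine mul_right_cancel₀ (ha0 x hx').ne' ?_
  have : d x = b x ^ 2 + a x * (r ^ 2 - ‖x‖ ^ 2) := rfl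
  have h3 : (l x * a x + b x) ^ 2 = d x := by rw [hla, neg_add_cancel_comm, hsq]
  linear_combination h3 + this

/-- **Brouwer's fixed point theorem**, for bounded continuous self-maps. -/
theorem exists_fixedPoint_of_continuous_of_bounded {E : Type*} [NormedAddCommGroup E]
    [InnerProductSpace ℝ E] [FiniteDimensional ℝ E] {F : E → E} (hF : Continuous F) {R : ℝ}
    (hR : ∀ x, ‖F x‖ ≤ R) : ∃ x, F x = x := by
  by_contra! hne
  have hR0 : 0 ≤ R := (norm_nonneg _).trans (hR 0)
  have hc : Continuous fun x => x - F x := continuous_id.sub hF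
  obtain ⟨u, hu, hclose, -⟩ := hc.exists_contDiff_approx 1
    (ε := fun x => min ‖x - F x‖ 1) (hc.norm.min continuous_const) fun x =>
      lt_min (norm_pos_iff.2 (sub_ne_zero.2 (hne x).symm)) one_pos
  -- Radius `R + 1` absorbs both the bound on `F` and an approximation error below `1`.
  obtain ⟨x, -, hx⟩ := exists_eq_zero_of_inner_pos_on_sphere (r := R + 1) (by linarith) hu
    fun x hx => by
      have hxr := mem_sphere_zero_iff_norm.1 hx
      have h1 : dist (u x) (x - F x) < 1 := (hclose x).trans_le (min_le_right _ _)
      rw [dist_eq_norm] at h1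
      have h2 : u x = x - F x + (u x - (x - F x)) := by abel
      have h3 := abs_real_inner_le_norm x (F x)
      have h4 := abs_real_inner_le_norm x (u x - (x - F x))
      rw [h2, inner_add_right, inner_sub_right, real_inner_self_eq_norm_sq]
      rw [hxr] at h3 h4 ⊢
      have h5 := (abs_le.1 h4).1
      have h6 := (abs_le.1 h3).2
      nlinarith [hR x]
  have := (hclose x).trans_le (min_le_left _ _)
  rw [hx, dist_zero_left] at this
  exact lt_irrefl _ this

/-! ### Lebesgue measure on the hyperplane of types. -/

theorem mem_sumZero {m : ℕ} {v : TypeVector m} : v ∈ sumZero m ↔ ∑ j, v j = 0 := by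
  simp [sumZero, LinearMap.sum_apply]

theorem hyperplaneVolume_level_set_eq_zero {m : ℕ} (w : Fin m → ℝ) {j₀ : Fin m} (hw : w j₀ ≠ 0) :
    hyperplaneVolume m {x | ∑ j, x j * w j = 0} = 0 := by
  have hm : (m : ℝ) ≠ 0 := by
    have := j₀.pos
    positivity
  have hmeas : MeasurableSet {x : TypeVector m | ∑ j, x j * w j = 0} :=
    measurableSet_eq_fun (by fun_prop) measurable_const
  rw [hyperplaneVolume, Measure.map_apply (by fun_prop) hmeas]
  let l : sumZero m →ₗ[ℝ] ℝ :=
    (∑ j, w j • (EuclideanSpace.proj j : TypeVector m →L[ℝ] ℝ).toLinearMap).comp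
      (sumZero m).subtype
  have hl : ∀ v : sumZero m, l v = ∑ j, (v : TypeVector m) j * w j := fun v => by
    simp [l, mul_comm]
  set S : Set (sumZero m) :=
    (fun v : sumZero m => barycentre m + (v : TypeVector m)) ⁻¹' {x | ∑ j, x j * w j = 0}
  have hS : ∀ v, v ∈ S ↔ l v = -∑ j, (m : ℝ)⁻¹ * w j := fun v => by
    simp only [S, Set.mem_preimage, Set.mem_ofPred_eq, PiLp.add_apply, add_mul,
      Finset.sum_add_distrib, hl, barycentre]
    rw [add_comm, add_eq_zero_iff_eq_neg]
  -- If `w` vanishes on `sumZero m`, it is a nonzero constant vector and the level set misses the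
  -- hyperplane; otherwise the level set is empty or a proper affine subspace.
  by_cases h0 : l = 0
  · have hwj : ∀ j, w j = w j₀ := by
      intro j
      have hv : EuclideanSpace.single j (1 : ℝ) - EuclideanSpace.single j₀ 1 ∈ sumZero m := by
        rw [mem_sumZero]
        simp [Finset.sum_sub_distrib]
      have h1 := hl ⟨_, hv⟩
      rw [h0] at h1
      simp [sub_mul, Finset.sum_sub_distrib] at h1
      linarith
    have : S = ∅ := by
      refine Set.eq_empty_iff_forall_notMem.2 fun v hv => hw ?_
      rw [hS, h0] at hv
      simp only [hwj, LinearMap.zero_apply, Finset.sum_const, Finset.card_univ, Fintype.card_fin,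
        nsmul_eq_mul] at hv
      rw [mul_inv_cancel_left₀ hm] at hv
      linarith
    rw [this, measure_empty]
  · rcases S.eq_empty_or_nonempty with h | ⟨p, hp⟩
    · rw [h, measure_empty]
    · have hk : LinearMap.ker l ≠ ⊤ := fun h => h0 (LinearMap.ker_eq_top.1 h)
      have hSp : S = (AffineSubspace.mk' p (LinearMap.ker l) : Set (sumZero m)) := by
        ext v
        rw [SetLike.mem_coe, AffineSubspace.mem_mk', vsub_eq_sub, LinearMap.mem_ker, map_sub,
          (hS p).1 hp, hS, sub_eq_zero]
      rw [hSp]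
      refine Measure.addHaar_affineSubspace _ _ fun h => hk ?_
      rw [← AffineSubspace.direction_mk' p (LinearMap.ker l), h, AffineSubspace.direction_top]

instance sigmaFinite_hyperplaneVolume (m : ℕ) : SigmaFinite (hyperplaneVolume m) := by
  have : MeasurableEmbedding fun v : sumZero m => barycentre m + (v : TypeVector m) :=
    ((Homeomorph.addLeft (barycentre m)).isClosedEmbedding.comp
      (sumZero m).closed_of_finiteDimensional.isClosedEmbedding_subtypeVal).measurableEmbedding
  exact this.sigmaFinite_map

/-! ### Expected gains and halfspace strategies. -/

namespace UniformMultigame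

variable {m n : ℕ}

theorem sigmaFinite_typeVolume {a : ℕ} (G : UniformMultigame m n a) (h : G.HasCompactTypes)
    (i : Fin n) : SigmaFinite (G.typeVolume i) := by
  refine SigmaFinite.of_map _ measurable_subtype_coe.aemeasurable ?_
  rw [typeVolume, map_comap_subtype_coe (h i).measurableSet]
  infer_instance

theorem ae_prior_sum_ne_zero {a : ℕ} (G : UniformMultigame m n a) (hc : G.HasCompactTypes)
    (hp : G.HasContinuousPrior) (i : Fin n) (k : {k : Fin n // k ≠ i}) (w : Fin m → ℝ)
    {j₀ : Fin m} (hw : w j₀ ≠ 0) :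
    ∀ᵐ t ∂(G.prior i), ∑ j, (t k : TypeVector m) j * w j ≠ 0 := by
  have := G.sigmaFinite_typeVolume hc
  have h0 : G.typeVolume k {θ | ∑ j, (θ : TypeVector m) j * w j = 0} = 0 := by
    rw [typeVolume, comap_subtype_coe_apply (hc k).measurableSet]
    refine measure_mono_null ?_ (hyperplaneVolume_level_set_eq_zero w hw)
    rintro _ ⟨θ, hθ, rfl⟩
    exact hθ
  have h1 := hp i (Measure.pi_eval_preimage_null
    (fun k : {k : Fin n // k ≠ i} => G.typeVolume k) h0)
  rw [ae_iff]
  refine measure_mono_null (fun t ht => ?_) h1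
  exact not_not.1 ht

/-- What agent `i` gains in the local game `j` by playing `C` instead of `D`. -/
def gain (G : UniformMultigame m n 2) (i : Fin n) (j : Fin m)
    (c' : {k : Fin n // k ≠ i} → Fin 2) : ℝ :=
  G.util i j (profile i actionC c') - G.util i j (profile i actionD c')

/-- The expected gain of agent `i` in the local game `j` from playing `C` instead of `D`. -/
noncomputable def expectedGain (G : UniformMultigame m n 2) (s : G.StrategyProfile) (i : Fin n)
    (j : Fin m) : ℝ :=
  ∫ t, G.gain i j (fun k => s k (t k)) ∂(G.prior i)

/-- The strategies that play `C` exactly at the types whose scalar product with the given weight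
vector is nonnegative. -/
noncomputable def halfspaceStrategy (G : UniformMultigame m n 2) (w : Fin n → Fin m → ℝ) :
    G.StrategyProfile := fun i θ =>
  open Classical in if 0 ≤ ∑ j, (θ : TypeVector m) j * w i j then actionC else actionD

/-- Truncation of a weight to the range of the gain of agent `i` in the local game `j`. -/
noncomputable def clampGain (G : UniformMultigame m n 2) (i : Fin n) (j : Fin m) (x : ℝ) : ℝ :=
  max (⨅ c', G.gain i j c') (min x (⨆ c', G.gain i j c'))

variable (G : UniformMultigame m n 2)

theorem iInf_gain_le (i : Fin n) (j : Fin m) (c') : ⨅ c', G.gain i j c' ≤ G.gain i j c' :=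
  ciInf_le (Set.finite_range _).bddBelow c'

theorem le_iSup_gain (i : Fin n) (j : Fin m) (c') : G.gain i j c' ≤ ⨆ c', G.gain i j c' :=
  le_ciSup (Set.finite_range _).bddAbove c'

theorem continuous_clampGain (i : Fin n) (j : Fin m) : Continuous (G.clampGain i j) := by
  unfold clampGain
  fun_prop

theorem clampGain_eq_self {i : Fin n} {j : Fin m} {x : ℝ} (h1 : ⨅ c', G.gain i j c' ≤ x)
    (h2 : x ≤ ⨆ c', G.gain i j c') : G.clampGain i j x = x := by
  rw [clampGain, min_eq_left h2, max_eq_right h1]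

/-- The gain in a pure game has constant sign and finitely many values, so its extrema are attained
and lie on one side of `0`. -/
theorem clampGain_ne_zero {i : Fin n} {j : Fin m}
    (h : G.IsPurelyCooperative i j ∨ G.IsPurelyCompetitive i j) (x : ℝ) :
    G.clampGain i j x ≠ 0 := by
  rcases h with h | h
  · obtain ⟨c', hc'⟩ := exists_eq_ciInf_of_finite (f := G.gain i j)
    have h1 : 0 < G.gain i j c' := sub_pos.2 (h c')
    rw [hc'] at h1
    exact (h1.trans_le (le_max_left _ _)).ne'
  · obtain ⟨c', hc'⟩ := exists_eq_ciSup_of_finite (f := G.gain i j)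
    have h1 : G.gain i j c' < 0 := sub_neg.2 (h c')
    have h2 := (G.iInf_gain_le i j c').trans_lt h1
    rw [hc'] at h1
    exact (max_lt h2 ((min_le_right _ _).trans_lt h1)).ne

theorem measurable_halfspaceStrategy (w : Fin n → Fin m → ℝ) (i : Fin n) :
    Measurable (G.halfspaceStrategy w i) :=
  Measurable.ite (measurableSet_le measurable_const (by fun_prop)) measurable_const measurable_const

theorem eventually_halfspaceStrategy_eq {X : Type*} [TopologicalSpace X] {f : X → Fin n → Fin m → ℝ}
    (hf : Continuous f) {x : X} {i : Fin n} {θ : G.types i}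
    (hθ : ∑ j, (θ : TypeVector m) j * f x i j ≠ 0) :
    ∀ᶠ y in nhds x, G.halfspaceStrategy (f y) i θ = G.halfspaceStrategy (f x) i θ := by
  have hc : Continuous fun y => ∑ j, (θ : TypeVector m) j * f y i j := by fun_prop
  rcases hθ.lt_or_gt with h | h
  · filter_upwards [hc.continuousAt.eventually (gt_mem_nhds h)] with y hy
    simp only [halfspaceStrategy, if_neg hy.not_ge, if_neg h.not_ge]
  · filter_upwards [hc.continuousAt.eventually (lt_mem_nhds h)] with y hy
    simp only [halfspaceStrategy, if_pos hy.le, if_pos h.le]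

theorem measurable_opponents {s : G.StrategyProfile} (hs : ∀ i, Measurable (s i)) (i : Fin n) :
    Measurable fun (t : ∀ k : {k : Fin n // k ≠ i}, G.types k) (k : {k : Fin n // k ≠ i}) => s k (t k) :=
  measurable_pi_lambda _ fun k => (hs k).comp (measurable_pi_apply k)

theorem integrable_opponents {s : G.StrategyProfile} (hs : ∀ i, Measurable (s i)) (i : Fin n)
    (f : ({k : Fin n // k ≠ i} → Fin 2) → ℝ) :
    Integrable (fun t => f fun k => s k (t k)) (G.prior i) := by
  have := G.prior_prob i
  obtain ⟨C, hC⟩ := (Set.finite_range fun c => ‖f c‖).bddAbove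
  exact Integrable.of_bound
    ((measurable_of_finite f).comp (G.measurable_opponents hs i)).aestronglyMeasurable C
    (.of_forall fun t => hC ⟨_, rfl⟩)

theorem iInf_gain_le_expectedGain {s : G.StrategyProfile} (hs : ∀ i, Measurable (s i)) (i : Fin n)
    (j : Fin m) : ⨅ c', G.gain i j c' ≤ G.expectedGain s i j := by
  have := G.prior_prob i
  simpa [expectedGain] using integral_mono (integrable_const _) (G.integrable_opponents hs i (G.gain i j))
    fun t => G.iInf_gain_le i j _

theorem expectedGain_le_iSup_gain {s : G.StrategyProfile} (hs : ∀ i, Measurable (s i)) (i : Fin n)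
    (j : Fin m) : G.expectedGain s i j ≤ ⨆ c', G.gain i j c' := by
  have := G.prior_prob i
  simpa [expectedGain] using integral_mono (G.integrable_opponents hs i (G.gain i j)) (integrable_const _)
    fun t => G.le_iSup_gain i j _

theorem expectedUtility_sub_expectedUtility {s : G.StrategyProfile} (hs : ∀ i, Measurable (s i))
    (i : Fin n) (θ : G.types i) :
    G.expectedUtility i actionC θ s - G.expectedUtility i actionD θ s =
      ∑ j, (θ : TypeVector m) j * G.expectedGain s i j := by
  have hint := G.integrable_opponents hs i
  unfold expectedUtility expectedGain
  rw [← integral_sub (hint fun c' => G.totalUtility i θ (profile i actionC c'))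
    (hint fun c' => G.totalUtility i θ (profile i actionD c'))]
  simp_rw [← integral_const_mul]
  rw [← integral_finsetSum _ fun j _ => (hint (G.gain i j)).const_mul _]
  refine integral_congr_ae (.of_forall fun t => ?_)
  simp only [totalUtility, gain, mul_sub, Finset.sum_sub_distrib]

theorem isPureBayesianNash_halfspaceStrategy {w : Fin n → Fin m → ℝ}
    (hw : ∀ i j, G.expectedGain (G.halfspaceStrategy w) i j = w i j) :
    G.IsPureBayesianNash (G.halfspaceStrategy w) := by
  refine ⟨G.measurable_halfspaceStrategy w, fun i θ c => ?_⟩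
  have h := G.expectedUtility_sub_expectedUtility (G.measurable_halfspaceStrategy w) i θ
  simp only [hw] at h
  by_cases h0 : 0 ≤ ∑ j, (θ : TypeVector m) j * w i j
  · have hs : G.halfspaceStrategy w i θ = actionC := if_pos h0
    rw [hs]
    fin_cases c
    · exact le_rfl
    · exact sub_nonneg.1 (h ▸ h0)
  · have hs : G.halfspaceStrategy w i θ = actionD := if_neg h0
    rw [hs]
    fin_cases c
    · exact (sub_neg.1 (h ▸ not_le.1 h0)).le
    · exact le_rfl

/-- Dominated convergence: for almost all opponents' types no pairing is zero, so their actions are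
locally constant in the parameter. -/
theorem continuous_expectedGain_halfspaceStrategy (hc : G.HasCompactTypes)
    (hp : G.HasContinuousPrior) {X : Type*} [TopologicalSpace X] [FirstCountableTopology X]
    {f : X → Fin n → Fin m → ℝ} (hf : Continuous f) (hf0 : ∀ x i, ∃ j, f x i j ≠ 0)
    (i : Fin n) (j : Fin m) :
    Continuous fun x => G.expectedGain (G.halfspaceStrategy (f x)) i j := by
  have := G.prior_prob i
  have hs := fun x => G.measurable_halfspaceStrategy (f x)
  obtain ⟨C, hC⟩ := (Set.finite_range fun c => ‖G.gain i j c‖).bddAbove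
  refine continuous_iff_continuousAt.2 fun x => ?_
  refine tendsto_integral_filter_of_dominated_convergence (fun _ => C)
    (.of_forall fun y => (G.integrable_opponents (hs y) i _).aestronglyMeasurable)
    (.of_forall fun y => .of_forall fun t => hC ⟨_, rfl⟩) (integrable_const _) ?_
  have hae : ∀ᵐ t ∂(G.prior i), ∀ k : {k : Fin n // k ≠ i},
      ∑ j, (t k : TypeVector m) j * f x k j ≠ 0 := by
    refine ae_all_iff.2 fun k => ?_
    obtain ⟨j₀, hj₀⟩ := hf0 x k
    exact G.ae_prior_sum_ne_zero hc hp i k (f x k) hj₀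
  filter_upwards [hae] with t ht
  refine tendsto_const_nhds.congr' ?_
  filter_upwards [Filter.eventually_all.2 fun k : {k : Fin n // k ≠ i} =>
    G.eventually_halfspaceStrategy_eq hf (ht k)] with y hy
  simp only [hy]

end UniformMultigame

theorem mainTheorem1 {m n : ℕ} (G : UniformMultigame m n 2)
    (hnorm : G.IsNormalized) (htypes : G.HasCompactTypes) (hprior : G.HasContinuousPrior)
    (hpure : ∀ i, ∃ j, G.IsPurelyCooperative i j ∨ G.IsPurelyCompetitive i j) :
    ∃ s : G.StrategyProfile, G.IsPureBayesianNash s := by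
  let f : EuclideanSpace ℝ (Fin n × Fin m) → Fin n → Fin m → ℝ :=
    fun w i j => G.clampGain i j (w (i, j))
  have hf : Continuous f := continuous_pi fun i => continuous_pi fun j =>
    (G.continuous_clampGain i j).comp (EuclideanSpace.proj (𝕜 := ℝ) (i, j)).continuous
  have hf0 : ∀ x i, ∃ j, f x i j ≠ 0 := fun x i =>
    (hpure i).imp fun j hj => G.clampGain_ne_zero hj _
  have hmeas := fun x => G.measurable_halfspaceStrategy (f x)
  let Φ : EuclideanSpace ℝ (Fin n × Fin m) → EuclideanSpace ℝ (Fin n × Fin m) := fun w =>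
    WithLp.toLp 2 fun p => G.expectedGain (G.halfspaceStrategy (f w)) p.1 p.2
  have hΦ : Continuous Φ := (PiLp.continuous_toLp 2 _).comp <| continuous_pi fun p =>
    G.continuous_expectedGain_halfspaceStrategy htypes hprior hf hf0 p.1 p.2
  obtain ⟨R, hR⟩ : ∃ R, ∀ w, ‖Φ w‖ ≤ R := by
    have hb := ((isCompact_univ_pi fun p : Fin n × Fin m =>
      isCompact_Icc (a := ⨅ c', G.gain p.1 p.2 c') (b := ⨆ c', G.gain p.1 p.2 c')).image
        (PiLp.continuous_toLp 2 _)).isBounded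
    obtain ⟨R, hR⟩ := hb.exists_norm_le
    exact ⟨R, fun w => hR _ ⟨_, fun p _ => ⟨G.iInf_gain_le_expectedGain (hmeas w) p.1 p.2,
      G.expectedGain_le_iSup_gain (hmeas w) p.1 p.2⟩, rfl⟩⟩
  obtain ⟨w, hw⟩ := exists_fixedPoint_of_continuous_of_bounded hΦ hR
  refine ⟨G.halfspaceStrategy (f w), G.isPureBayesianNash_halfspaceStrategy fun i j => ?_⟩
  have hij : G.expectedGain (G.halfspaceStrategy (f w)) i j = w (i, j) :=
    congrArg (fun v : EuclideanSpace ℝ (Fin n × Fin m) => v (i, j)) hw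
  rw [hij]
  -- The fixed point consists of expected gains, which already lie in the clamping range.
  refine (G.clampGain_eq_self ?_ ?_).symm <;> rw [← hij]
  · exact G.iInf_gain_le_expectedGain (hmeas w) i j
  · exact G.expectedGain_le_iSup_gain (hmeas w) i j
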